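/- Let $\mathrm{Prop}$ be a finite set of propositional variables. A Kripke model $M=(\mathrm{dom}(M),R^M,v^M)$ consists of a set $\mathrm{dom}(M)$, a relation $R^M\subseteq \mathrm{dom}(M)\times\mathrm{dom}(M)$ and a map $v^M:\mathrm{dom}(M)\to\mathcal P(\mathrm{Prop})$; a pointed model $(M,s)$ is a Kripke model together with some $s\in\mathrm{dom}(M)$. The empty loopstate $\circlearrowright_\emptyset$ (full loopstate $\circlearrowright_{\mathrm{Prop}}$) is the pointed model with a single, reflexive point, at which no (every) $p\in\mathrm{Prop}$ is true. Write $\underline{\leftrightarrow}$ for bisimilarity of pointed models. A weak simulation from $(M,s)$ to $(M',s')$ is a relation $Z\subseteq\mathrm{dom}(M)\times\mathrm{dom}(M')$ with $(s,s')\in Z$ such that for all $(t,t')\in Z$: - (atom) $v^M(t)\subseteq v^{M'}(t')$; - (forth$'$) if $R^M t u$, then either $M,u\;\underline{\leftrightarrow}\;\circlearrowright_\emptyset$ or there is $u'$ with $R^{M'}t'u'$ and $(u,u')\in Z$; - (back$'$) if $R^{M'}t'u'$, then either $M',u'\;\underline{\leftrightarrow}\;\circlearrowright_{\mathrm{Prop}}$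 or there is $u$ with $R^M t u$ and $(u,u')\in Z$. View Kripke models as first-order structures over the signature with one binary relation symbol $R$ and one unary relation symbol for each $p\in\mathrm{Prop}$. Let $\alpha(x)$ be a first-order formula (with equality) over this signature with at most the free variable $x$. Say that $\alpha(x)$ is preserved under weak simulations if $M\models\alpha[s]$ implies $M'\models\alpha[s']$ whenever there is a weak simulation from $(M,s)$ to $(M',s')$. Let $\mathcal L_{\Box,\Diamond,\wedge,\vee}$ be the set of modal formulas generated from the variables in $\mathrm{Prop}$ using only $\Box,\Diamond,\wedge,\vee$, and let $ST_x(\varphi)$ denote the standard translation of a modal formula $\varphi$ into first-order logic. **Theorem.** The formula $\alpha(x)$ is preserved under weak simulations if and only if there is $\varphi\in\mathcal L_{\Box,\Diamond,\wedge,\vee}\cup\{\top,\bot\}$ (that is, $\varphi\in\mathcal L_{\Box,\Diamond,\wedge,\vee}$, or $\varphi=\top$, or $\varphi=\bot$) such that $\alpha(x)$ is equivalent to $ST_x(\varphi)$, i.e. such that $M\models\alpha[s]\iff M\models ST_x(\varphi)[s]$ for every pointed model $(M,s)$. -/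

import Mathlib

universe u

namespace WeakSim

/-! ### Modal formulas -/

/-- The full modal language over the set `P` of propositional variables, in negation normal form:
`⊤`, `⊥`, `p`, `¬p`, `φ ∧ ψ`, `φ ∨ ψ`, `◇φ`, `□φ`. -/
inductive ModalFormula (P : Type u) : Type u
  | top : ModalFormula P
  | bot : ModalFormula P
  | var (p : P) : ModalFormula P
  | negVar (p : P) : ModalFormula P
  | and (φ ψ : ModalFormula P) : ModalFormula P
  | or (φ ψ : ModalFormula P) : ModalFormula P
  | dia (φ : ModalFormula P) : ModalFormula P
  | box (φ : ModalFormula P) : ModalFormula P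

/-- `IsMonotone φ` says that `φ` is generated from propositional variables using only
`□`, `◇`, `∧`, `∨` (so neither `⊤` nor `⊥` nor a negated variable occurs in it). -/
inductive IsMonotone {P : Type u} : ModalFormula P → Prop
  | var (p : P) : IsMonotone (.var p)
  | and {φ ψ : ModalFormula P} (hφ : IsMonotone φ) (hψ : IsMonotone ψ) : IsMonotone (.and φ ψ)
  | or {φ ψ : ModalFormula P} (hφ : IsMonotone φ) (hψ : IsMonotone ψ) : IsMonotone (.or φ ψ)
  | dia {φ : ModalFormula P} (hφ : IsMonotone φ) : IsMonotone (.dia φ)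
  | box {φ : ModalFormula P} (hφ : IsMonotone φ) : IsMonotone (.box φ)

/-- The modal language with the operators `□`, `◇`, `∧`, `∨` over the variables `P`. -/
def monotoneFragment (P : Type u) : Set (ModalFormula P) := {φ | IsMonotone φ}

/-! ### Kripke models, bisimulations and weak simulations -/

/-- A Kripke model over `P`: a set of worlds, an accessibility relation, and a colouring that
assigns to every world the set of propositional variables true there. A pointed model is given by
a model `M` together with a world `s : M.dom`. -/
structure KripkeModel (P : Type u) : Type (u + 1) where
  dom : Type u
  R : dom → dom → Prop
  v : dom → Set P

/-- `Z` is a bisimulation between the pointed models `(M, s)` and `(N, t)`. -/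
structure IsBisimulation {P : Type u} (M : KripkeModel P) (s : M.dom) (N : KripkeModel P)
    (t : N.dom) (Z : M.dom → N.dom → Prop) : Prop where
  base : Z s t
  atom : ∀ x y, Z x y → M.v x = N.v y
  forth : ∀ x y, Z x y → ∀ x', M.R x x' → ∃ y', N.R y y' ∧ Z x' y'
  back : ∀ x y, Z x y → ∀ y', N.R y y' → ∃ x', M.R x x' ∧ Z x' y'

/-- The pointed models `(M, s)` and `(N, t)` are bisimilar. -/
def Bisimilar {P : Type u} (M : KripkeModel P) (s : M.dom) (N : KripkeModel P) (t : N.dom) :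
    Prop :=
  ∃ Z : M.dom → N.dom → Prop, IsBisimulation M s N t Z

/-- The model with a single reflexive world, coloured by `c`; its point is `PUnit.unit`. The empty
loopstate is `loopstate ∅` and the full loopstate is `loopstate Set.univ`. -/
def loopstate {P : Type u} (c : Set P) : KripkeModel P where
  dom := PUnit
  R := fun _ _ => True
  v := fun _ => c

/-- `Z` is a weak simulation from the pointed model `(M, s)` to the pointed model `(N, t)`. -/
structure IsWeakSimulation {P : Type u} (M : KripkeModel P) (s : M.dom) (N : KripkeModel P)
    (t : N.dom) (Z : M.dom → N.dom → Prop) : Prop where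
  base : Z s t
  atom : ∀ x y, Z x y → M.v x ⊆ N.v y
  forth : ∀ x y, Z x y → ∀ x', M.R x x' →
    Bisimilar M x' (loopstate ∅) PUnit.unit ∨ ∃ y', N.R y y' ∧ Z x' y'
  back : ∀ x y, Z x y → ∀ y', N.R y y' →
    Bisimilar N y' (loopstate Set.univ) PUnit.unit ∨ ∃ x', M.R x x' ∧ Z x' y'

/-- `(N, t)` weakly simulates `(M, s)`. -/
def WeaklySimulatedBy {P : Type u} (M : KripkeModel P) (s : M.dom) (N : KripkeModel P)
    (t : N.dom) : Prop :=
  ∃ Z : M.dom → N.dom → Prop, IsWeakSimulation M s N t Z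

/-! ### The first-order correspondence language -/

/-- The relation symbols: one binary symbol and a unary symbol for every `p : P`. -/
inductive KripkeRel (P : Type u) : ℕ → Type u
  | acc : KripkeRel P 2
  | pred (p : P) : KripkeRel P 1

/-- The signature with one binary relation and a unary relation for every `p : P`. -/
def kripkeLanguage (P : Type u) : FirstOrder.Language.{0, u} := ⟨fun _ => Empty, KripkeRel P⟩

/-- The binary relation symbol. -/
def accSymb (P : Type u) : (kripkeLanguage P).Relations 2 := KripkeRel.acc

/-- The unary relation symbol of `p`. -/
def predSymb {P : Type u} (p : P) : (kripkeLanguage P).Relations 1 := KripkeRel.pred p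

/-- A Kripke model viewed as a first-order structure. -/
instance KripkeModel.foStructure {P : Type u} (M : KripkeModel P) :
    (kripkeLanguage P).Structure M.dom where
  funMap := fun f _ => Empty.elim f
  RelMap := fun r xs => match r, xs with
    | .acc, xs => M.R (xs 0) (xs 1)
    | .pred p, xs => p ∈ M.v (xs 0)

/-- A first-order formula `α(x)` with (at most) one free variable `x`, equality being allowed. -/
abbrev FOFormula (P : Type u) : Type u := (kripkeLanguage P).Formula (Fin 1)

/-- `M ⊨ α[s]`. -/
def FOSat {P : Type u} (M : KripkeModel P) (s : M.dom) (α : FOFormula P) : Prop :=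
  α.Realize (fun _ => s)

/-- Auxiliary form of the standard translation: the translation of a modal formula at the variable
`x`, which is either the free variable or one of `n` variables in the scope of quantifiers. The
quantifiers of the translation bind the next variable `Fin.last n`. -/
def standardTranslationAt {P : Type u} :
    ModalFormula P → (n : ℕ) → Fin 1 ⊕ Fin n → (kripkeLanguage P).BoundedFormula (Fin 1) n
  | .top, _, _ => ⊤
  | .bot, _, _ => ⊥
  | .var p, _, x =>
      (predSymb p).boundedFormula₁ (FirstOrder.Language.Term.var x)
  | .negVar p, _, x =>
      ((predSymb p).boundedFormula₁ (FirstOrder.Language.Term.var x)).not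
  | .and φ ψ, n, x => standardTranslationAt φ n x ⊓ standardTranslationAt ψ n x
  | .or φ ψ, n, x => standardTranslationAt φ n x ⊔ standardTranslationAt ψ n x
  | .dia φ, n, x =>
      ((accSymb P).boundedFormula₂
          (FirstOrder.Language.Term.var (Sum.map id Fin.castSucc x))
          (FirstOrder.Language.Term.var (Sum.inr (Fin.last n)))
        ⊓ standardTranslationAt φ (n + 1) (Sum.inr (Fin.last n))).ex
  | .box φ, n, x =>
      (((accSymb P).boundedFormula₂
          (FirstOrder.Language.Term.var (Sum.map id Fin.castSucc x))
          (FirstOrder.Language.Term.var (Sum.inr (Fin.last n)))).imp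
        (standardTranslationAt φ (n + 1) (Sum.inr (Fin.last n)))).all

/-- The standard translation `ST_x(φ)` of a modal formula `φ`. -/
def standardTranslation {P : Type u} (φ : ModalFormula P) : FOFormula P :=
  standardTranslationAt φ 0 (Sum.inl 0)

/-- Two first-order formulas `α(x)`, `β(x)` are equivalent: they are satisfied by the same
pointed models. -/
def FOEquivalent {P : Type u} (α β : FOFormula P) : Prop :=
  ∀ (M : KripkeModel P) (s : M.dom), FOSat M s α ↔ FOSat M s β

/-- The first-order formula `α(x)` is preserved under weak simulations. -/
def PreservedUnderWeakSimulations {P : Type u} (α : FOFormula P) : Prop :=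
  ∀ (M : KripkeModel P) (s : M.dom) (N : KripkeModel P) (t : N.dom),
    WeaklySimulatedBy M s N t → FOSat M s α → FOSat N t α

end WeakSim

/-! Monotone formulas are false at the empty loopstate and true at the full one, so the escape
clauses of a weak simulation never affect their preservation.

Conversely, let α be preserved. The empty loopstate is weakly simulated by every pointed model, and
the full one weakly simulates every pointed model. Hence α is ⊤ if it holds at the empty loopstate,
and ⊥ if it fails at the full one.

In the remaining case a Hennessy–Milner argument applies: between modally saturated models,
preservation of monotone formulas is itself a weak simulation
(`weaklySimulatedBy_of_isModallySaturated`). Ultraproducts over ℕ are modally saturated, so by Łoś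
they serve as both compactness and saturation: if no finite set of monotone formulas controlled α,
the ultraproducts of the counterexamples would violate preservation (`exists_bound`). Then α is the
finite disjunction, over the types realised by its models, of the conjunctions of those types. The
values of α at the loopstates make all of these nonempty, so neither ⊤ nor ⊥ is needed. -/

namespace WeakSim

open FirstOrder FirstOrder.Language

variable {P : Type u}

/-! ### Kripke semantics of modal formulas -/

/-- `Sat M s φ`: the modal formula `φ` is true at the world `s` of `M`. -/
def Sat (M : KripkeModel P) : M.dom → ModalFormula P → Prop
  | _, .top => True
  | _, .bot => False
  | s, .var p => p ∈ M.v s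
  | s, .negVar p => p ∉ M.v s
  | s, .and φ ψ => Sat M s φ ∧ Sat M s ψ
  | s, .or φ ψ => Sat M s φ ∨ Sat M s ψ
  | s, .dia φ => ∃ t, M.R s t ∧ Sat M t φ
  | s, .box φ => ∀ t, M.R s t → Sat M t φ

theorem relMap_accSymb (M : KripkeModel P) (s t : M.dom) :
    Structure.RelMap (accSymb P) ![s, t] ↔ M.R s t := Iff.rfl

theorem relMap_predSymb (M : KripkeModel P) (p : P) (s : M.dom) :
    Structure.RelMap (predSymb p) ![s] ↔ p ∈ M.v s := Iff.rfl

theorem realize_standardTranslationAt (M : KripkeModel P) (φ : ModalFormula P) :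
    ∀ (n : ℕ) (x : Fin 1 ⊕ Fin n) (v : Fin 1 → M.dom) (xs : Fin n → M.dom),
      (standardTranslationAt φ n x).Realize v xs ↔ Sat M (Sum.elim v xs x) φ := by
  have key : ∀ (n : ℕ) (x : Fin 1 ⊕ Fin n) (v : Fin 1 → M.dom) (xs : Fin n → M.dom) (a : M.dom),
      Sum.elim v (Fin.snoc xs a : Fin (n + 1) → M.dom) (Sum.map id Fin.castSucc x) =
        Sum.elim v xs x := by
    rintro n (x | x) v xs a <;> simp
  induction φ with
  | top => intro n x v xs; simp [standardTranslationAt, Sat]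
  | bot => intro n x v xs; simp [standardTranslationAt, Sat]
  | var p => intro n x v xs; simp [standardTranslationAt, Sat, relMap_predSymb]
  | negVar p => intro n x v xs; simp [standardTranslationAt, Sat, relMap_predSymb]
  | and φ ψ hφ hψ => intro n x v xs; simp [standardTranslationAt, Sat, hφ, hψ]
  | or φ ψ hφ hψ => intro n x v xs; simp [standardTranslationAt, Sat, hφ, hψ]
  | dia φ hφ => intro n x v xs; simp [standardTranslationAt, Sat, hφ, key, relMap_accSymb]
  | box φ hφ => intro n x v xs; simp [standardTranslationAt, Sat, hφ, key, relMap_accSymb]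

theorem fosat_standardTranslation (M : KripkeModel P) (s : M.dom) (φ : ModalFormula P) :
    FOSat M s (standardTranslation φ) ↔ Sat M s φ :=
  realize_standardTranslationAt M φ 0 (Sum.inl 0) _ _

/-- The negation of a modal formula, in negation normal form. -/
def ModalFormula.neg : ModalFormula P → ModalFormula P
  | .top => .bot
  | .bot => .top
  | .var p => .negVar p
  | .negVar p => .var p
  | .and φ ψ => .or φ.neg ψ.neg
  | .or φ ψ => .and φ.neg ψ.neg
  | .dia φ => .box φ.neg
  | .box φ => .dia φ.neg

theorem sat_neg (M : KripkeModel P) (φ : ModalFormula P) (s : M.dom) :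
    Sat M s φ.neg ↔ ¬ Sat M s φ := by
  induction φ generalizing s with
  | and φ ψ hφ hψ => simp only [ModalFormula.neg, Sat, hφ, hψ]; tauto
  | _ => simp_all [ModalFormula.neg, Sat]

/-- An injective numbering of modal formulas, built from a numbering of the variables. -/
def ModalFormula.code (e : P → ℕ) : ModalFormula P → ℕ
  | .top => Nat.pair 0 0
  | .bot => Nat.pair 1 0
  | .var p => Nat.pair 2 (e p)
  | .negVar p => Nat.pair 3 (e p)
  | .and φ ψ => Nat.pair 4 (Nat.pair (φ.code e) (ψ.code e))
  | .or φ ψ => Nat.pair 5 (Nat.pair (φ.code e) (ψ.code e))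
  | .dia φ => Nat.pair 6 (φ.code e)
  | .box φ => Nat.pair 7 (φ.code e)

theorem ModalFormula.code_injective {e : P → ℕ} (he : Function.Injective e) :
    Function.Injective (ModalFormula.code e) := by
  intro φ
  induction φ with
  | top | bot =>
    intro χ h
    cases χ <;> simp_all [ModalFormula.code, Nat.pair_eq_pair]
  | var p | negVar p =>
    intro χ h
    cases χ <;> simp_all [ModalFormula.code, Nat.pair_eq_pair, he.eq_iff]
  | and φ ψ hφ hψ | or φ ψ hφ hψ =>
    intro χ h
    cases χ <;> simp only [ModalFormula.code, Nat.pair_eq_pair] at h <;> try omega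
    rw [hφ h.2.1, hψ h.2.2]
  | dia φ hφ | box φ hφ =>
    intro χ h
    cases χ <;> simp only [ModalFormula.code, Nat.pair_eq_pair] at h <;> try omega
    rw [hφ h.2]

instance [Countable P] : Countable (ModalFormula P) :=
  let ⟨_, he⟩ := exists_injective_nat P
  (ModalFormula.code_injective he).countable

/-! ### Monotone formulas -/

theorem sat_congr_of_bisimilar {M N : KripkeModel P} {s : M.dom} {t : N.dom}
    (h : Bisimilar M s N t) (φ : ModalFormula P) : Sat M s φ ↔ Sat N t φ := by
  obtain ⟨Z, hZ⟩ := h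
  suffices H : ∀ x y, Z x y → (Sat M x φ ↔ Sat N y φ) from H s t hZ.base
  induction φ with
  | top | bot => simp [Sat]
  | var p | negVar p => intro x y h; simp [Sat, hZ.atom x y h]
  | and φ ψ hφ hψ | or φ ψ hφ hψ => intro x y h; simp [Sat, hφ x y h, hψ x y h]
  | dia φ hφ =>
    intro x y h
    constructor
    · rintro ⟨x', hx', hs⟩
      obtain ⟨y', hy', hz⟩ := hZ.forth x y h x' hx'
      exact ⟨y', hy', (hφ _ _ hz).1 hs⟩
    · rintro ⟨y', hy', hs⟩
      obtain ⟨x', hx', hz⟩ := hZ.back x y h y' hy'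
      exact ⟨x', hx', (hφ _ _ hz).2 hs⟩
  | box φ hφ =>
    intro x y h
    constructor
    · intro hs y' hy'
      obtain ⟨x', hx', hz⟩ := hZ.back x y h y' hy'
      exact (hφ _ _ hz).1 (hs x' hx')
    · intro hs x' hx'
      obtain ⟨y', hy', hz⟩ := hZ.forth x y h x' hx'
      exact (hφ _ _ hz).2 (hs y' hy')

theorem IsMonotone.not_sat_loopstate_empty {φ : ModalFormula P} (hφ : IsMonotone φ)
    (x : (loopstate (∅ : Set P)).dom) : ¬ Sat (loopstate ∅) x φ := by
  induction hφ generalizing x with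
  | var p => simp [Sat, loopstate]
  | and _ _ h _ => exact fun hs => h x hs.1
  | or _ _ h h' => exact fun hs => hs.elim (h x) (h' x)
  | dia _ h => exact fun ⟨t, _, ht⟩ => h t ht
  | box _ h => exact fun hs => h x (hs x trivial)

theorem IsMonotone.sat_loopstate_univ {φ : ModalFormula P} (hφ : IsMonotone φ)
    (x : (loopstate (Set.univ : Set P)).dom) : Sat (loopstate Set.univ) x φ := by
  induction hφ generalizing x with
  | var p => simp [Sat, loopstate]
  | and _ _ h h' => exact ⟨h x, h' x⟩
  | or _ _ h _ => exact Or.inl (h x)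
  | dia _ h => exact ⟨x, trivial, h x⟩
  | box _ h => exact fun t _ => h t

theorem IsMonotone.sat_of_isWeakSimulation {M N : KripkeModel P} {s : M.dom} {t : N.dom}
    {Z : M.dom → N.dom → Prop} (hZ : IsWeakSimulation M s N t Z) {φ : ModalFormula P}
    (hφ : IsMonotone φ) {x : M.dom} {y : N.dom} (hxy : Z x y) (hs : Sat M x φ) : Sat N y φ := by
  induction hφ generalizing x y with
  | var p => exact hZ.atom x y hxy hs
  | and _ _ h h' => exact ⟨h hxy hs.1, h' hxy hs.2⟩
  | or _ _ h h' => exact hs.imp (h hxy) (h' hxy)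
  | dia hψ h =>
    obtain ⟨x', hx', hs⟩ := hs
    rcases hZ.forth x y hxy x' hx' with hb | ⟨y', hy', hz⟩
    · exact (hψ.not_sat_loopstate_empty _ ((sat_congr_of_bisimilar hb _).1 hs)).elim
    · exact ⟨y', hy', h hz hs⟩
  | box hψ h =>
    intro y' hy'
    rcases hZ.back x y hxy y' hy' with hb | ⟨x', hx', hz⟩
    · exact (sat_congr_of_bisimilar hb _).2 (hψ.sat_loopstate_univ _)
    · exact h hz (hs x' hx')

/-- Nonemptiness is essential: the empty conjunction is ⊤, which no monotone formula expresses. -/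
theorem exists_isMonotone_sat_iff_forall {ι : Type*} (f : ι → ModalFormula P) {T : Finset ι}
    (hT : T.Nonempty) (hf : ∀ i ∈ T, IsMonotone (f i)) :
    ∃ ψ, IsMonotone ψ ∧ ∀ (M : KripkeModel P) (s : M.dom),
      Sat M s ψ ↔ ∀ i ∈ T, Sat M s (f i) := by
  induction hT using Finset.Nonempty.cons_induction with
  | singleton a => exact ⟨f a, hf a (by simp), by simp⟩
  | cons a T _ _ ih =>
    obtain ⟨ψ, hψ, h⟩ := ih fun i hi => hf i (by simp [hi])
    exact ⟨.and (f a) ψ, .and (hf a (by simp)) hψ, fun M s => by simp [Sat, h]⟩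

theorem exists_isMonotone_sat_iff_exists {ι : Type*} (f : ι → ModalFormula P) {T : Finset ι}
    (hT : T.Nonempty) (hf : ∀ i ∈ T, IsMonotone (f i)) :
    ∃ ψ, IsMonotone ψ ∧ ∀ (M : KripkeModel P) (s : M.dom),
      Sat M s ψ ↔ ∃ i ∈ T, Sat M s (f i) := by
  induction hT using Finset.Nonempty.cons_induction with
  | singleton a => exact ⟨f a, hf a (by simp), by simp⟩
  | cons a T _ _ ih =>
    obtain ⟨ψ, hψ, h⟩ := ih fun i hi => hf i (by simp [hi])
    exact ⟨.or (f a) ψ, .or (hf a (by simp)) hψ, fun M s => by simp [Sat, h]⟩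

/-! ### Weak simulations between modally saturated models -/

/-- `M` is modally saturated: a set of modal formulas that is finitely satisfiable among the
successors of a world is satisfied at one of them. -/
def IsModallySaturated (M : KripkeModel P) : Prop :=
  ∀ (s : M.dom) (Γ : Set (ModalFormula P)),
    (∀ T : Finset (ModalFormula P), ↑T ⊆ Γ → ∃ t, M.R s t ∧ ∀ φ ∈ T, Sat M t φ) →
      ∃ t, M.R s t ∧ ∀ φ ∈ Γ, Sat M t φ

/-- Saturation is applied to the negated formulas, which is why it is required for the full modal
language. -/
theorem IsModallySaturated.exists_forall_not_sat {M : KripkeModel P} (hM : IsModallySaturated M)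
    (s : M.dom) (Γ : Set (ModalFormula P))
    (h : ∀ T : Finset (ModalFormula P), ↑T ⊆ Γ → ∃ t, M.R s t ∧ ∀ φ ∈ T, ¬ Sat M t φ) :
    ∃ t, M.R s t ∧ ∀ φ ∈ Γ, ¬ Sat M t φ := by
  classical
  obtain ⟨t, ht, H⟩ := hM s (ModalFormula.neg '' Γ) fun T hT => by
    obtain ⟨T, hTΓ, rfl⟩ := Finset.subset_set_image_iff.1 hT
    obtain ⟨t, ht, H⟩ := h T hTΓ
    refine ⟨t, ht, fun φ hφ => ?_⟩
    obtain ⟨ψ, hψ, rfl⟩ := Finset.mem_image.1 hφ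
    exact (sat_neg M ψ t).2 (H ψ hψ)
  exact ⟨t, ht, fun φ hφ => (sat_neg M φ t).1 (H _ ⟨φ, hφ, rfl⟩)⟩

/-- A successor satisfying a set of monotone formulas exists as soon as `◇ψ` holds for every
nonempty conjunction `ψ` of formulas in the set. -/
theorem IsModallySaturated.exists_sat_of_dia {M : KripkeModel P} (hM : IsModallySaturated M)
    {s : M.dom} {Γ : Set (ModalFormula P)} (hΓ : ∀ φ ∈ Γ, IsMonotone φ) (hne : Γ.Nonempty)
    (h : ∀ ψ, IsMonotone ψ →
      (∀ (N : KripkeModel P) (t : N.dom), (∀ φ ∈ Γ, Sat N t φ) → Sat N t ψ) → Sat M s (.dia ψ)) :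
    ∃ t, M.R s t ∧ ∀ φ ∈ Γ, Sat M t φ := by
  classical
  obtain ⟨φ₀, hφ₀⟩ := hne
  refine hM s Γ fun T hT => ?_
  -- Adding `φ₀` keeps the conjunction nonempty even when `T` is empty.
  have hT' : ∀ φ ∈ insert φ₀ T, φ ∈ Γ := by
    intro φ hφ
    rcases Finset.mem_insert.1 hφ with rfl | hφ
    exacts [hφ₀, hT hφ]
  obtain ⟨ψ, hψ, H⟩ := exists_isMonotone_sat_iff_forall id (T.insert_nonempty φ₀)
    fun φ hφ => hΓ φ (hT' φ hφ)
  obtain ⟨t, ht, hs⟩ := h ψ hψ fun N t hN => (H N t).2 fun φ hφ => hN φ (hT' φ hφ)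
  exact ⟨t, ht, fun φ hφ => (H M t).1 hs φ (Finset.mem_insert_of_mem hφ)⟩

/-- A successor falsifying a set of monotone formulas exists as soon as `□ψ` fails for every
nonempty disjunction `ψ` of formulas in the set. -/
theorem IsModallySaturated.exists_not_sat_of_box {M : KripkeModel P} (hM : IsModallySaturated M)
    {s : M.dom} {Γ : Set (ModalFormula P)} (hΓ : ∀ φ ∈ Γ, IsMonotone φ) (hne : Γ.Nonempty)
    (h : ∀ ψ, IsMonotone ψ →
      (∀ (N : KripkeModel P) (t : N.dom), (∀ φ ∈ Γ, ¬ Sat N t φ) → ¬ Sat N t ψ) →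
        ¬ Sat M s (.box ψ)) :
    ∃ t, M.R s t ∧ ∀ φ ∈ Γ, ¬ Sat M t φ := by
  classical
  obtain ⟨φ₀, hφ₀⟩ := hne
  refine hM.exists_forall_not_sat s Γ fun T hT => ?_
  have hT' : ∀ φ ∈ insert φ₀ T, φ ∈ Γ := by
    intro φ hφ
    rcases Finset.mem_insert.1 hφ with rfl | hφ
    exacts [hφ₀, hT hφ]
  obtain ⟨ψ, hψ, H⟩ := exists_isMonotone_sat_iff_exists id (T.insert_nonempty φ₀)
    fun φ hφ => hΓ φ (hT' φ hφ)
  have hs := h ψ hψ fun N t hN hs => by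
    obtain ⟨φ, hφ, hφs⟩ := (H N t).1 hs
    exact hN φ (hT' φ hφ) hφs
  simp only [Sat, not_forall] at hs
  obtain ⟨t, ht, hs⟩ := hs
  exact ⟨t, ht, fun φ hφ hφs => hs ((H M t).2 ⟨φ, Finset.mem_insert_of_mem hφ, hφs⟩)⟩

/-- Falsifying all monotone formulas passes to every successor, since each ◇φ fails. As each □ψ
fails too, saturation gives a successor of this kind, matching the loop. -/
theorem IsModallySaturated.bisimilar_loopstate_empty [Nonempty P] {M : KripkeModel P}
    (hM : IsModallySaturated M) {s : M.dom} (hs : ∀ φ, IsMonotone φ → ¬ Sat M s φ) :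
    Bisimilar M s (loopstate ∅) PUnit.unit := by
  refine ⟨fun x _ => ∀ φ, IsMonotone φ → ¬ Sat M x φ, hs, fun x _ h => ?_,
    fun x _ h x' hx' => ⟨PUnit.unit, trivial, fun φ hφ hs => h _ hφ.dia ⟨x', hx', hs⟩⟩,
    fun x _ h _ _ => ?_⟩
  · exact Set.eq_empty_of_forall_notMem fun p => h _ (.var p)
  · exact hM.exists_not_sat_of_box (Γ := monotoneFragment P) (fun _ hφ => hφ)
      ⟨.var (Classical.arbitrary P), .var _⟩ fun ψ hψ _ => h _ hψ.box

theorem IsModallySaturated.bisimilar_loopstate_univ [Nonempty P] {M : KripkeModel P}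
    (hM : IsModallySaturated M) {s : M.dom} (hs : ∀ φ, IsMonotone φ → Sat M s φ) :
    Bisimilar M s (loopstate Set.univ) PUnit.unit := by
  refine ⟨fun x _ => ∀ φ, IsMonotone φ → Sat M x φ, hs, fun x _ h => ?_,
    fun x _ h x' hx' => ⟨PUnit.unit, trivial, fun φ hφ => h _ hφ.box x' hx'⟩,
    fun x _ h _ _ => ?_⟩
  · exact Set.eq_univ_of_forall fun p => h _ (.var p)
  · exact hM.exists_sat_of_dia (Γ := monotoneFragment P) (fun _ hφ => hφ)
      ⟨.var (Classical.arbitrary P), .var _⟩ fun ψ hψ _ => h _ hψ.dia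

/-- Between modally saturated models, preservation of the monotone formulas is a weak
simulation. -/
theorem weaklySimulatedBy_of_isModallySaturated [Nonempty P] {M N : KripkeModel P}
    (hM : IsModallySaturated M) (hN : IsModallySaturated N) {s : M.dom} {t : N.dom}
    (h : ∀ φ, IsMonotone φ → Sat M s φ → Sat N t φ) : WeaklySimulatedBy M s N t := by
  refine ⟨fun x y => ∀ φ, IsMonotone φ → Sat M x φ → Sat N y φ, h, fun x y hxy p hp =>
    hxy _ (.var p) hp, fun x y hxy x' hx' => ?_, fun x y hxy y' hy' => ?_⟩
  · rw [or_iff_not_imp_left]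
    intro hb
    -- The fragment lacks ⊤, so this set can be empty; the forth clause exempts exactly that case.
    have hne : {φ | IsMonotone φ ∧ Sat M x' φ}.Nonempty := by
      by_contra hemp
      exact hb (hM.bisimilar_loopstate_empty fun φ hφ hs => hemp ⟨φ, hφ, hs⟩)
    obtain ⟨y', hy', H⟩ := hN.exists_sat_of_dia (s := y) (fun φ hφ => hφ.1) hne
      fun ψ hψ hs => hxy _ hψ.dia ⟨x', hx', hs M x' fun φ hφ => hφ.2⟩
    exact ⟨y', hy', fun φ hφ hs => H φ ⟨hφ, hs⟩⟩
  · rw [or_iff_not_imp_left]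
    intro hb
    -- Dually, what is false at `y'` must be made false at some successor of `x`.
    have hne : {φ | IsMonotone φ ∧ ¬ Sat N y' φ}.Nonempty := by
      by_contra hemp
      exact hb (hN.bisimilar_loopstate_univ fun φ hφ => by_contra fun hs => hemp ⟨φ, hφ, hs⟩)
    obtain ⟨x', hx', H⟩ := hM.exists_not_sat_of_box (s := x) (fun φ hφ => hφ.1) hne
      fun ψ hψ hs hbox => hs N y' (fun φ hφ => hφ.2) (hxy _ hψ.box hbox y' hy')
    exact ⟨x', hx', fun φ hφ hs => by_contra fun hns => H φ ⟨hφ, hns⟩ hs⟩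

/-! ### Ultraproducts of Kripke models -/

/-- The ultraproduct of a sequence of Kripke models along the nonprincipal ultrafilter
`Filter.hyperfilter ℕ`. -/
noncomputable def ultraproduct (M : ℕ → KripkeModel P) : KripkeModel P where
  dom := (Filter.hyperfilter ℕ : Filter ℕ).Product fun n => (M n).dom
  R := fun x y => Structure.RelMap (accSymb P) ![x, y]
  v := fun x => {p | Structure.RelMap (predSymb p) ![x]}

/-- The world of the ultraproduct represented by a sequence of worlds. -/
noncomputable def ultraproduct.mk (M : ℕ → KripkeModel P) (s : ∀ n, (M n).dom) : (ultraproduct M).dom :=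
  Quotient.mk'' s

theorem ultraproduct.exists_mk_eq {M : ℕ → KripkeModel P} (x : (ultraproduct M).dom) :
    ∃ s, ultraproduct.mk M s = x :=
  Quotient.exists_rep x

/-- Identifies the structure read off the Kripke model with the one for which Łoś's theorem is
stated. -/
theorem ultraproduct.foStructure_eq (M : ℕ → KripkeModel P) :
    (ultraproduct M).foStructure = (Ultraproduct.structure :
      (kripkeLanguage P).Structure
        ((Filter.hyperfilter ℕ : Filter ℕ).Product fun n => (M n).dom)) := by
  refine Structure.ext ?_ ?_
  · funext n f
    exact Empty.elim f
  · funext n r xs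
    match n, r, xs with
    | _, .acc, xs =>
      refine congrArg (Structure.RelMap (accSymb P)) (funext fun i => ?_)
      fin_cases i <;> rfl
    | _, .pred p, xs =>
      refine congrArg (Structure.RelMap (predSymb p)) (funext fun i => ?_)
      fin_cases i
      rfl

/-- Łoś's theorem for Kripke models. -/
theorem ultraproduct.fosat_mk (M : ℕ → KripkeModel P) (s : ∀ n, (M n).dom) (α : FOFormula P) :
    FOSat (ultraproduct M) (ultraproduct.mk M s) α ↔
      ∀ᶠ n in (Filter.hyperfilter ℕ : Filter ℕ), FOSat (M n) (s n) α := by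
  have : ∀ n, Nonempty (M n).dom := fun n => ⟨s n⟩
  unfold FOSat
  rw [ultraproduct.foStructure_eq]
  exact Ultraproduct.realize_formula_cast α fun _ => s

theorem ultraproduct.sat_mk (M : ℕ → KripkeModel P) (s : ∀ n, (M n).dom) (φ : ModalFormula P) :
    Sat (ultraproduct M) (ultraproduct.mk M s) φ ↔
      ∀ᶠ n in (Filter.hyperfilter ℕ : Filter ℕ), Sat (M n) (s n) φ := by
  simp only [← fosat_standardTranslation, ultraproduct.fosat_mk]

theorem ultraproduct.r_mk (M : ℕ → KripkeModel P) (s t : ∀ n, (M n).dom) :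
    (ultraproduct M).R (ultraproduct.mk M s) (ultraproduct.mk M t) ↔
      ∀ᶠ n in (Filter.hyperfilter ℕ : Filter ℕ), (M n).R (s n) (t n) := by
  have : ∀ n, Nonempty (M n).dom := fun n => ⟨s n⟩
  have h := Ultraproduct.realize_formula_cast (u := Filter.hyperfilter ℕ)
    ((accSymb P).formula₂ (Term.var (0 : Fin 2)) (Term.var 1)) ![s, t]
  simp only [Formula.realize_rel₂, Term.realize_var, relMap_accSymb] at h
  exact h

/-- The diagonal argument behind the countable saturation of ultraproducts over `ℕ`. -/
theorem exists_forall_eventually_of_forall_eventually_exists {X : ℕ → Type*}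
    [∀ n, Nonempty (X n)] {l : Filter ℕ} (hl : l ≤ Filter.atTop) (Q : ∀ n, ℕ → X n → Prop)
    (h : ∀ k, ∀ᶠ n in l, ∃ x, ∀ i < k, Q n i x) : ∃ x : ∀ n, X n, ∀ i, ∀ᶠ n in l, Q n i (x n) := by
  classical
  let A : ℕ → ℕ → Prop := fun n k => ∃ x, ∀ i < k, Q n i x
  -- At index n, satisfy as many initial conditions as possible, at most n of them; zero conditions
  -- are always satisfiable.
  have hA : ∀ n, A n (Nat.findGreatest (A n) n) := fun n =>
    Nat.findGreatest_spec (P := A n) (Nat.zero_le n) ⟨Classical.arbitrary _, by simp⟩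
  choose x hx using hA
  refine ⟨x, fun i => ?_⟩
  filter_upwards [h (i + 1), hl (Filter.eventually_ge_atTop (i + 1))] with n hn hin
  exact hx n i (Nat.le_findGreatest hin hn)

theorem ultraproduct.isModallySaturated [Countable P] (M : ℕ → KripkeModel P) :
    IsModallySaturated (ultraproduct M) := by
  classical
  intro s Γ h
  obtain ⟨s, rfl⟩ := ultraproduct.exists_mk_eq s
  have : ∀ n, Nonempty (M n).dom := fun n => ⟨s n⟩
  have : Nonempty (ModalFormula P) := ⟨.top⟩
  obtain ⟨f, hf⟩ := exists_surjective_nat (ModalFormula P)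
  obtain ⟨t, ht⟩ := exists_forall_eventually_of_forall_eventually_exists Nat.hyperfilter_le_atTop
    -- Accessibility is part of every condition, so the diagonal sequence is a successor; formulas
    -- outside `Γ` impose nothing more.
    (fun n i (x : (M n).dom) => (M n).R (s n) x ∧ (f i ∈ Γ → Sat (M n) x (f i))) fun k => by
      obtain ⟨t, ht, H⟩ := h (((Finset.range k).image f).filter (· ∈ Γ))
        fun φ hφ => (Finset.mem_filter.1 hφ).2
      obtain ⟨t, rfl⟩ := ultraproduct.exists_mk_eq t
      have hk : ∀ i ∈ Finset.range k, ∀ᶠ n in (Filter.hyperfilter ℕ : Filter ℕ),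
          f i ∈ Γ → Sat (M n) (t n) (f i) := by
        intro i hi
        by_cases hiΓ : f i ∈ Γ
        · simpa [hiΓ] using (ultraproduct.sat_mk M t (f i)).1
            (H _ (by simpa [hiΓ] using ⟨i, by simpa using hi, rfl⟩))
        · simp [hiΓ]
      filter_upwards [(ultraproduct.r_mk M s t).1 ht, (Filter.eventually_all_finset _).2 hk]
        with n hR hn
      exact ⟨t n, fun i hi => ⟨hR, hn i (Finset.mem_range.2 hi)⟩⟩
  refine ⟨ultraproduct.mk M t, (ultraproduct.r_mk M s t).2 ((ht 0).mono fun n hn => hn.1),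
    fun φ hφ => ?_⟩
  obtain ⟨i, rfl⟩ := hf φ
  exact (ultraproduct.sat_mk M t _).2 ((ht i).mono fun n hn => hn.2 hφ)

/-! ### The preservation theorem -/

theorem preservedUnderWeakSimulations_standardTranslation {φ : ModalFormula P}
    (hφ : φ ∈ monotoneFragment P ∪ {ModalFormula.top, ModalFormula.bot}) :
    PreservedUnderWeakSimulations (standardTranslation φ) := by
  rintro M s N t ⟨Z, hZ⟩
  simp only [fosat_standardTranslation]
  rcases hφ with hφ | rfl | rfl
  · exact IsMonotone.sat_of_isWeakSimulation hZ hφ hZ.base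
  · exact id
  · exact id

/-- The total relation works: the loop falls under the escape clause of forth, and it answers every
step of `N` in back. -/
theorem weaklySimulatedBy_loopstate_empty (N : KripkeModel P) (t : N.dom) :
    WeaklySimulatedBy (loopstate ∅) PUnit.unit N t :=
  ⟨fun _ _ => True, trivial, fun _ _ _ => Set.empty_subset _,
    fun _ _ _ _ _ => Or.inl ⟨fun _ _ => True, trivial, fun _ _ _ => rfl,
      fun _ _ _ _ _ => ⟨PUnit.unit, trivial, trivial⟩,
      fun _ _ _ _ _ => ⟨PUnit.unit, trivial, trivial⟩⟩,
    fun _ _ _ _ _ => Or.inr ⟨PUnit.unit, trivial, trivial⟩⟩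

theorem weaklySimulatedBy_loopstate_univ (M : KripkeModel P) (s : M.dom) :
    WeaklySimulatedBy M s (loopstate Set.univ) PUnit.unit :=
  ⟨fun _ _ => True, trivial, fun _ _ _ => Set.subset_univ _,
    fun _ _ _ _ _ => Or.inr ⟨PUnit.unit, trivial, trivial⟩,
    fun _ _ _ _ _ => Or.inl ⟨fun _ _ => True, trivial, fun _ _ _ => rfl,
      fun _ _ _ _ _ => ⟨PUnit.unit, trivial, trivial⟩,
      fun _ _ _ _ _ => ⟨PUnit.unit, trivial, trivial⟩⟩⟩

/-- A formula preserved under weak simulations depends, monotonically, on the truth of finitely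
many monotone formulas. -/
theorem PreservedUnderWeakSimulations.exists_bound [Countable P] [Nonempty P] {α : FOFormula P}
    (hα : PreservedUnderWeakSimulations α) {f : ℕ → ModalFormula P}
    (hf : ∀ φ, IsMonotone φ → ∃ i, f i = φ) :
    ∃ n, ∀ (M : KripkeModel P) (s : M.dom) (N : KripkeModel P) (t : N.dom), FOSat M s α →
      (∀ i < n, Sat M s (f i) → Sat N t (f i)) → FOSat N t α := by
  -- The n-th counterexample preserves the first n formulas, so the i-th formula is preserved at all
  -- indices n > i, hence in the ultraproduct.
  by_contra! h
  choose M s N t hs hst ht using h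
  have hM : FOSat (ultraproduct M) (ultraproduct.mk M s) α :=
    (ultraproduct.fosat_mk M s α).2 (.of_forall hs)
  refine ((ultraproduct.fosat_mk N t α).1 (hα _ _ _ _ (weaklySimulatedBy_of_isModallySaturated
    (ultraproduct.isModallySaturated M) (ultraproduct.isModallySaturated N) ?_) hM)).exists.elim ht
  intro φ hφ hsat
  obtain ⟨i, rfl⟩ := hf φ hφ
  rw [ultraproduct.sat_mk] at hsat ⊢
  filter_upwards [hsat, Nat.hyperfilter_le_atTop (Filter.eventually_gt_atTop i)] with n hn hin
  exact hst n i hin hn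

theorem PreservedUnderWeakSimulations.exists_isMonotone [Countable P] [Nonempty P]
    {α : FOFormula P} (hα : PreservedUnderWeakSimulations α)
    (hempty : ¬ FOSat (loopstate ∅) PUnit.unit α)
    (huniv : FOSat (loopstate Set.univ) PUnit.unit α) :
    ∃ φ, IsMonotone φ ∧ FOEquivalent α (standardTranslation φ) := by
  classical
  have : Nonempty {φ : ModalFormula P // IsMonotone φ} := ⟨_, .var (Classical.arbitrary P)⟩
  obtain ⟨g, hg⟩ := exists_surjective_nat {φ : ModalFormula P // IsMonotone φ}
  obtain ⟨n, hn⟩ := hα.exists_bound (f := fun i => (g i).1) fun φ hφ =>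
    (hg ⟨φ, hφ⟩).imp fun i hi => congrArg Subtype.val hi
  let τ (M : KripkeModel P) (s : M.dom) : Finset ℕ :=
    (Finset.range n).filter fun i => Sat M s (g i).1
  have hτ : ∀ (M : KripkeModel P) (s : M.dom), FOSat M s α → (τ M s).Nonempty := by
    intro M s hs
    by_contra hemp
    -- With an empty type the bound would transfer α vacuously to the empty loopstate.
    refine hempty (hn M s _ _ hs fun i hi hsat => (hemp ⟨i, ?_⟩).elim)
    simp [τ, hi, hsat]
  let A : Finset (Finset ℕ) := (Finset.range n).powerset.filter fun T =>
    ∃ (M : KripkeModel P) (s : M.dom), FOSat M s α ∧ T = τ M s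
  have hmem : ∀ (M : KripkeModel P) (s : M.dom), FOSat M s α → τ M s ∈ A := fun M s hs =>
    Finset.mem_filter.2 ⟨Finset.mem_powerset.2 (Finset.filter_subset _ _), M, s, hs, rfl⟩
  have hconj : ∀ T : Finset ℕ, ∃ ψ : ModalFormula P, T.Nonempty → IsMonotone ψ ∧
      ∀ (M : KripkeModel P) (s : M.dom), Sat M s ψ ↔ ∀ i ∈ T, Sat M s (g i).1 := by
    intro T
    by_cases hT : T.Nonempty
    · obtain ⟨ψ, hψ⟩ := exists_isMonotone_sat_iff_forall (fun i => (g i).1) hT fun i _ => (g i).2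
      exact ⟨ψ, fun _ => hψ⟩
    -- A dummy value: only nonempty types occur in `A`.
    · exact ⟨.top, fun h => (hT h).elim⟩
  choose ψ hψ using hconj
  have hA : ∀ T ∈ A, T.Nonempty := by
    intro T hT
    obtain ⟨-, M, s, hs, rfl⟩ := Finset.mem_filter.1 hT
    exact hτ M s hs
  -- The type of the full loopstate makes the disjunction nonempty.
  obtain ⟨φ, hφ, H⟩ := exists_isMonotone_sat_iff_exists ψ ⟨_, hmem _ _ huniv⟩
    fun T hT => (hψ T (hA T hT)).1
  refine ⟨φ, hφ, fun N t => ?_⟩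
  rw [fosat_standardTranslation, H]
  constructor
  · intro ht
    refine ⟨τ N t, hmem N t ht, ((hψ _ (hτ N t ht)).2 N t).2 fun i hi => ?_⟩
    exact (Finset.mem_filter.1 hi).2
  · rintro ⟨T, hT, hsat⟩
    have hsat := ((hψ T (hA T hT)).2 N t).1 hsat
    obtain ⟨-, M, s, hs, rfl⟩ := Finset.mem_filter.1 hT
    exact hn M s N t hs fun i hi hi' =>
      hsat i (Finset.mem_filter.2 ⟨Finset.mem_range.2 hi, hi'⟩)

end WeakSim

theorem theorem4p8 {P : Type u} [Finite P] (α : WeakSim.FOFormula P) :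
    WeakSim.PreservedUnderWeakSimulations α ↔
      ∃ φ ∈ WeakSim.monotoneFragment P ∪ {WeakSim.ModalFormula.top, WeakSim.ModalFormula.bot},
        WeakSim.FOEquivalent α (WeakSim.standardTranslation φ) := by
  open WeakSim in
  constructor
  · intro hα
    by_cases hempty : FOSat (loopstate ∅) PUnit.unit α
    · refine ⟨.top, by simp, fun N t => ?_⟩
      rw [fosat_standardTranslation]
      exact iff_of_true (hα _ _ N t (weaklySimulatedBy_loopstate_empty N t) hempty) trivial
    by_cases huniv : FOSat (loopstate Set.univ) PUnit.unit α
    -- Without variables the two loopstates coincide, yet α separates them.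
    · have : Nonempty P := by
        by_contra hP
        rw [not_nonempty_iff] at hP
        rw [Set.univ_eq_empty_iff.2 hP] at huniv
        exact hempty huniv
      obtain ⟨φ, hφ, h⟩ := hα.exists_isMonotone hempty huniv
      exact ⟨φ, Or.inl hφ, h⟩
    · refine ⟨.bot, by simp, fun M s => ?_⟩
      rw [fosat_standardTranslation]
      exact iff_of_false
        (fun hs => huniv (hα M s _ _ (weaklySimulatedBy_loopstate_univ M s) hs)) id
  · rintro ⟨φ, hφ, h⟩ M s N t hst hs
    exact (h N t).2 (preservedUnderWeakSimulations_standardTranslation hφ M s N t hst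
      ((h M s).1 hs))
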